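/- Define $T_k(z)$ by $T_0=2$, $T_1=z$, $T_k=zT_{k-1}-T_{k-2}$. Let $n\ge 1$, and let $CM_n(z)$ be the $n\times n$ circulant matrix over a commutative ring with first row $(-z,1,0,\dots,0,1)$, where indices are taken modulo $n$ and coinciding entries add up (so the first row is $(-z,2)$ for $n=2$ and $(-z+2)$ for $n=1$). Then $$\det CM_n(z)=(-1)^n\,(T_n(z)-2).$$ For an oriented link $L$ with a diagram in the plane, color the regions of the diagram in checkerboard fashion so that the unbounded region $X_0$ is white, and let $X_0,X_1,\dots,X_m$ be the white regions. For a crossing $p$ let $\eta(p)=+1$ if the over-strand, rotated counterclockwise until it meets the under-strand, sweeps the black corners, and $\eta(p)=-1$ otherwise. Call $p$ of type II if the black corners at $p$ are the one between the two incoming ends and the one between the two outgoing ends. The unreduced Goeritz matrix $(g_{ij})_{0\le i,j\le m}$ has $g_{ij}=-\sum_p\eta(p)$ for $i\ne j$, where $p$ runs over the crossings that connect $X_i$ and $X_j$, and $g_{ii}=-\sum_{k\ne i}g_{ik}$; the Goeritz matrix $G$ arises from it by removing the row and the column of $X_0$. Let $\beta$ be the number of components of the graph whose vertices are the black regions and whose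 edges are the crossings, and let $H=G\oplus A\oplus B$, where $A$ is diagonal with entries $-\eta(p)$, $p$ running over the crossings of type II, and $B$ is the zero matrix of size $\beta-1$. The determinant of $L$ is $Det_L=\det(\sqrt{-1}\,H)$. For $n\ge 0$ let $Th_n$ be the $n$th Turk-head link, the closure of the 3-braid $(\sigma_1\sigma_2^{-1})^n$, with the standard closed braid diagram, all braid strands being oriented in the same direction. Then, computed from this diagram, $$Det_{Th_n}=T_n(3)-2=\Big(\frac{3+\sqrt5}{2}\Big)^n+\Big(\frac{3-\sqrt5}{2}\Big)^n-2 .$$ In particular $Det_{Th_2}=5$, $Det_{Th_3}=16$, $Det_{Th_4}=45$, $Det_{Th_5}=121$, $Det_{Th_6}=320$, $Det_{Th_7}=841$ and $Det_{Th_8}=2205$. -/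

import Mathlib

/-! ### Oriented link diagrams

A link diagram in the plane is put in general position with respect to a height function and read
from bottom to top.  It is then a finite stack of elementary slices, each of which contains exactly
one local minimum (cup), one local maximum (cap) or one crossing, besides vertical strands.
Strands at a given height are numbered `0, 1, …` from left to right, and their directions are
recorded in a `List Bool`, with `true` for upwards and `false` for downwards. -/

/-- An elementary slice of an oriented link diagram.
* `cup j d`: a local minimum, which creates the strands `j` (of direction `d`) and `j + 1`
  (of direction `!d`);
* `cap j`: a local maximum, which joins the strands `j` and `j + 1`;
* `cross j s`: the strands `j` and `j + 1` cross; the over-strand is the one that runs from the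
  lower left to the upper right if `s = true`, and the one that runs from the lower right to the
  upper left if `s = false`. -/
inductive Slice : Type
  | cup (j : ℕ) (d : Bool)
  | cap (j : ℕ)
  | cross (j : ℕ) (s : Bool)

namespace Slice

/-- The number of strands to the left of the cup, cap or crossing. -/
def pos : Slice → ℕ
  | cup j _ => j
  | cap j => j
  | cross j _ => j

/-- The slice contains a crossing. -/
def IsCross : Slice → Prop
  | cross _ _ => True
  | _ => False

/-- The slice contains a crossing whose over-strand runs from the lower left to the upper right. -/
def OverRising : Slice → Prop
  | cross _ s => s = true
  | _ => False

/-- The directions of the strands above the slice, from those below it. -/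
def apply : Slice → List Bool → List Bool
  | cup j d, l => l.take j ++ [d, !d] ++ l.drop j
  | cap j, l => l.take j ++ l.drop (j + 2)
  | cross j _, l => l.take j ++ ((l.drop j).take 2).reverse ++ l.drop (j + 2)

/-- The slice fits on top of strands with the directions `l`.  A cap has to join strands of
opposite directions. -/
def Fits : Slice → List Bool → Prop
  | cup j _, l => j ≤ l.length
  | cap j, l => j + 1 < l.length ∧ l[j]? ≠ l[j + 1]?
  | cross j _, l => j + 1 < l.length

/-- A horizontal line that meets `k` strands is cut by them into the gaps `0, …, k`, from left to
right.  `s.Joins g h` says that inside the slice `s` the gap `g` below it and the gap `h` above it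
belong to one connected piece of the complement of the diagram. -/
def Joins : Slice → ℕ → ℕ → Prop
  | cup j _, g, h => (g ≤ j ∧ h = g) ∨ (j ≤ g ∧ h = g + 2)
  | cap j, g, h => (h ≤ j ∧ g = h) ∨ (j ≤ h ∧ g = h + 2)
  | cross j _, g, h => g ≠ j + 1 ∧ h = g

theorem Joins.even_iff {s : Slice} {g h : ℕ} (H : s.Joins g h) : Even g ↔ Even h := by
  cases s <;> simp only [Joins] at H <;> grind

end Slice

/-- The slices fit on top of each other, starting from strands with directions `l`, and no strand
is left at the top. -/
def Closes : List Bool → List Slice → Prop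
  | l, [] => l = []
  | l, s :: ss => s.Fits l ∧ Closes (s.apply l) ss

/-- An oriented link diagram in the plane. -/
structure LinkDiagram where
  /-- the slices, from bottom to top -/
  slices : List Slice
  closes : Closes [] slices

namespace LinkDiagram

variable (D : LinkDiagram)

/-- The directions of the strands at height `t`, i.e. between the slices `t - 1` and `t`. -/
def level (t : ℕ) : List Bool :=
  (D.slices.take t).foldl (fun l s => s.apply l) []

/-- The gaps of the diagram: pairs of a height `t` and a gap between the strands at height `t`. -/
abbrev Gap : Type :=
  Σ t : Fin (D.slices.length + 1), Fin ((D.level t).length + 1)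

/-- The gap `p` lies directly below, and `q` directly above, some slice, inside which they are
connected in the complement of the diagram. -/
def Joined (p q : D.Gap) : Prop :=
  ∃ t : Fin D.slices.length,
    (p.1 : ℕ) = t ∧ (q.1 : ℕ) = t + 1 ∧ (D.slices[t]).Joins p.2 q.2

/-- The regions into which the plane is divided by the diagram: the classes of gaps for the
equivalence relation generated by `Joined`. -/
def Region : Type := Quot D.Joined

/-- The region that contains a gap. -/
def region (p : D.Gap) : D.Region := Quot.mk _ p

/-- The unbounded region; at height `0` there are no strands, and so there is one gap only. -/
def outer : D.Region := D.region ⟨0, 0⟩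

/-- The checkerboard coloring in which the unbounded region is white. -/
def IsWhite : D.Region → Prop :=
  Quot.lift (fun p : D.Gap => Even (p.2 : ℕ))
    (fun _ _ h => propext (h.choose_spec.2.2.even_iff))

theorem isWhite_outer : D.IsWhite D.outer := by
  show Even ((0 : Fin _) : ℕ)
  simp

/-- The crossings of the diagram. -/
def Crossing : Type := {t : Fin D.slices.length // (D.slices[t]).IsCross}

instance : Finite D.Region := inferInstanceAs (Finite (Quot D.Joined))

noncomputable instance : Fintype D.Region := Fintype.ofFinite _

noncomputable instance : Fintype D.Crossing :=
  @Fintype.ofFinite _ (inferInstanceAs (Finite {t : Fin D.slices.length // (D.slices[t]).IsCross}))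

variable {D}

/-- The number of strands to the left of a crossing. -/
def Crossing.pos (c : D.Crossing) : ℕ := (D.slices[c.1]).pos

/-- The regions above and below the crossing are black, and those to its left and right white;
otherwise it is the other way round. -/
def Crossing.BlackVertical (c : D.Crossing) : Prop := Odd (c.pos + 1)

/-- `p` and `q` are opposite corners at the crossing `c`: the lower and the upper one, or the left
and the right one. -/
def Crossing.Opposite (c : D.Crossing) (p q : D.Gap) : Prop :=
  ((p.1 : ℕ) = c.1 ∧ (q.1 : ℕ) = c.1 + 1 ∧ (p.2 : ℕ) = c.pos + 1 ∧ (q.2 : ℕ) = c.pos + 1) ∨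
  ((p.1 : ℕ) = c.1 ∧ (q.1 : ℕ) = c.1 ∧ (p.2 : ℕ) = c.pos ∧ (q.2 : ℕ) = c.pos + 2)

/-- The crossing `c` connects the regions `X` and `Y`: they meet as opposite corners at `c`. -/
def Crossing.Connects (c : D.Crossing) (X Y : D.Region) : Prop :=
  ∃ p q : D.Gap, c.Opposite p q ∧
    ((D.region p = X ∧ D.region q = Y) ∨ (D.region p = Y ∧ D.region q = X))

open Classical in
/-- The sign `η(c)`, which does not depend on the orientation: it is `+1` if the over-strand,
rotated counterclockwise about the crossing until it meets the under-strand, sweeps the black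
corners, and `-1` if it sweeps the white ones. -/
noncomputable def Crossing.eta (c : D.Crossing) : ℤ :=
  if ((D.slices[c.1]).OverRising ↔ c.BlackVertical) then 1 else -1

/-- The two strands at the crossing are both directed upwards or both downwards. -/
def Crossing.Parallel (c : D.Crossing) : Prop :=
  (D.level c.1)[c.pos]? = (D.level c.1)[c.pos + 1]?

/-- The crossing is of type II: at the crossing, the orientation of the strands is not the boundary
orientation of any orientation of the black surface, that is, the black corners are the one between
the two incoming and the one between the two outgoing ends.  All other crossings are of type I. -/
def Crossing.IsTypeII (c : D.Crossing) : Prop := c.Parallel ↔ c.BlackVertical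

variable (D)

/-- The white regions. -/
abbrev WhiteRegion : Type := {X : D.Region // D.IsWhite X}

/-- The black regions. -/
abbrev BlackRegion : Type := {X : D.Region // ¬ D.IsWhite X}

/-- The unbounded region as a white region. -/
def whiteOuter : D.WhiteRegion := ⟨D.outer, D.isWhite_outer⟩

open Classical in
/-- Minus the sum of the signs of the crossings that connect two white regions. -/
noncomputable def goeritzEntry (X Y : D.WhiteRegion) : ℤ :=
  -∑ c : D.Crossing with c.Connects X Y, c.eta

open Classical in
/-- The unreduced Goeritz matrix; its rows add up to zero. -/
noncomputable def unreducedGoeritz : Matrix D.WhiteRegion D.WhiteRegion ℤ :=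
  Matrix.of fun X Y =>
    if X = Y then -∑ Z : D.WhiteRegion with Z ≠ X, D.goeritzEntry X Z else D.goeritzEntry X Y

/-- The (reduced) Goeritz matrix: the row and the column of the unbounded region are removed. -/
noncomputable def goeritz :
    Matrix {X : D.WhiteRegion // X ≠ D.whiteOuter} {X : D.WhiteRegion // X ≠ D.whiteOuter} ℤ :=
  D.unreducedGoeritz.submatrix Subtype.val Subtype.val

/-- The graph whose vertices are the black regions, joined if they meet at a crossing. -/
def blackGraph : SimpleGraph D.BlackRegion :=
  SimpleGraph.fromRel fun X Y => ∃ c : D.Crossing, c.Connects X Y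

/-- The number of connected components of the black graph. -/
noncomputable def beta : ℕ := Nat.card D.blackGraph.ConnectedComponent

/-- The crossings of type II. -/
abbrev TypeII : Type := {c : D.Crossing // c.IsTypeII}

open Classical in
/-- The generalized Goeritz matrix, with the blocks `G` (the Goeritz matrix), `A` (diagonal, with
entries `-η(c)` for the crossings `c` of type II) and `B` (zero, of size `β - 1`, where `β ≥ 1`
unless the diagram is empty). -/
noncomputable def generalizedGoeritz :
    Matrix ({X : D.WhiteRegion // X ≠ D.whiteOuter} ⊕ (D.TypeII ⊕ Fin (D.beta - 1)))
      ({X : D.WhiteRegion // X ≠ D.whiteOuter} ⊕ (D.TypeII ⊕ Fin (D.beta - 1))) ℤ :=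
  Matrix.fromBlocks D.goeritz 0 0
    (Matrix.fromBlocks (Matrix.diagonal fun c : D.TypeII => -c.1.eta) 0 0 0)

open Classical in
/-- The determinant `det (i H)` of an oriented link, from a diagram of it. -/
noncomputable def Det : ℂ :=
  (Complex.I • D.generalizedGoeritz.map (Int.cast : ℤ → ℂ)).det

end LinkDiagram

/-! ### Closed braids -/

/-- A braid word on `m` strands: `(i, true)` stands for the generator `σ_{i+1}` and `(i, false)`
for its inverse. -/
abbrev BraidWord (m : ℕ) : Type := List (Fin (m - 1) × Bool)

namespace BraidWord

/-- The directions of `m` downward strands followed by `m` upward strands. -/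
def strands (m : ℕ) : List Bool := List.replicate m false ++ List.replicate m true

/-- The slices of the closure of a braid.  The braid is drawn upwards on the strands
`m, …, 2m - 1`, and the closing strands run downwards on its left; `σ_i` is a positive crossing
and `σ_i⁻¹` a negative one. -/
def closureSlices (m : ℕ) (w : BraidWord m) : List Slice :=
  (List.range m).map (fun j => Slice.cup j false) ++
    (w.map (fun x => Slice.cross (m + x.1) x.2) ++ (List.range m).reverse.map Slice.cap)

theorem cap_strands (m : ℕ) : Closes (strands m) ((List.range m).reverse.map Slice.cap) := by
  induction m with
  | zero => simp [strands, Closes]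
  | succ m ih =>
    rw [List.range_succ, List.reverse_append]
    refine ⟨⟨?_, ?_⟩, ?_⟩
    · simp [strands]
    · simp [strands, List.getElem?_append]
    · have : (Slice.cap m).apply (strands (m + 1)) = strands m := by
        simp [Slice.apply, strands, List.take_append, List.drop_append]
      show Closes ((Slice.cap m).apply (strands (m + 1))) _
      rw [this]
      exact ih

theorem cross_strands (m : ℕ) (w : BraidWord m) (ss : List Slice) (h : Closes (strands m) ss) :
    Closes (strands m) (w.map (fun x => Slice.cross (m + x.1) x.2) ++ ss) := by
  induction w with
  | nil => exact h
  | cons x w ih =>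
    have hx := x.1.2
    refine ⟨?_, ?_⟩
    · simp [Slice.Fits, strands]; omega
    · have : (Slice.cross (m + x.1) x.2).apply (strands m) = strands m := by
        simp [Slice.apply, strands, List.take_append, List.drop_append]
        rw [show m - (m + (x.1 : ℕ) + 2) = 0 by omega, List.replicate_zero, List.nil_append,
          ← List.replicate_add]
        congr 1
        omega
      show Closes ((Slice.cross (m + x.1) x.2).apply (strands m)) _
      rw [this]
      exact ih

theorem cup_strands (m k : ℕ) (ss : List Slice) (h : Closes (strands (m + k)) ss) :
    Closes (strands m) ((List.range' m k).map (fun j => Slice.cup j false) ++ ss) := by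
  induction k generalizing m with
  | zero => exact h
  | succ k ih =>
    refine ⟨?_, ?_⟩
    · simp [Slice.Fits, strands]
    · have : (Slice.cup m false).apply (strands m) = strands (m + 1) := by
        simp [Slice.apply, strands, List.replicate_succ' (n := m) (a := false), List.replicate_succ (n := m) (a := true)]
      show Closes ((Slice.cup m false).apply (strands m)) _
      rw [this]
      exact ih (m + 1) (by rwa [show m + 1 + k = m + (k + 1) by omega])

/-- The oriented link diagram that is the closure of a braid. -/
def closure (m : ℕ) (w : BraidWord m) : LinkDiagram where
  slices := closureSlices m w
  closes := by
    have h := cup_strands 0 m _ (by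
      rw [Nat.zero_add]
      exact cross_strands m w _ (cap_strands m))
    rw [← List.range_eq_range'] at h
    exact h

end BraidWord

/-- The Turk-head link: the closure of the 3-braid `(σ₁ σ₂⁻¹) ^ n`. -/
def turkHead (n : ℕ) : LinkDiagram :=
  BraidWord.closure 3 (List.replicate n [((0 : Fin 2), true), ((1 : Fin 2), false)]).flatten

/-! ### The circulant matrix -/

/-- The `n × n` circulant matrix with first row `(-z, 1, 0, …, 0, 1)`.  Indices are taken modulo
`n`, and entries at coinciding places add up, so that the first row is `(-z, 2)` for `n = 2` and
`(-z + 2)` for `n = 1`. -/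
def circulantCM {R : Type*} [CommRing R] (n : ℕ) [NeZero n] (z : R) : Matrix (Fin n) (Fin n) R :=
  Matrix.circulant fun j : Fin n =>
    (if j = 0 then -z else 0) + (if j = 1 then 1 else 0) + (if j = -1 then 1 else 0)

/-! Circulant determinant: let `P` be the cyclic permutation matrix, so `CM_n(z) = -z + P + Pᵀ`. If
`z = x + y` with `xy = 1`, then `(x - P)(x - P)ᵀ = -x · CM_n(z)`, while `det (x - P) = x ^ n - 1`.
Hence `(-x) ^ n det CM_n(z) = (x ^ n - 1) ^ 2 = x ^ n (x ^ n + y ^ n - 2)`, and `x ^ n + y ^ n =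
T_n(z)`. Over an arbitrary ring such an `x` is found in the extension `R[X]/(X² - zX + 1)`, into
which `R` embeds (`det_circulantCM`).

Turk-head links: for `n ≥ 1` the white regions form a wheel. Its hub is the unbounded region and its
rim consists of the `n` pieces of the annulus between the middle and the innermost closing strand.
Each `σ₁` joins cyclically consecutive pieces, each `σ₂⁻¹` joins a piece to the hub, and all signs
are `-1` because the diagram is alternating. So the Goeritz matrix is `CM_n(3)`
(`unreducedGoeritz_some_some`). The type II crossings are the `n` generators `σ₂⁻¹`, which
contribute an identity block, and the black graph is connected (`beta_eq_one`). Thus `H` has size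
`2n`, and the factor `i ^ (2n) = (-1) ^ n` cancels the sign of the circulant determinant. For `n =
0` both sides vanish. -/

/-! ### The determinant of the circulant matrix. -/

open Polynomial in
/-- A root `x` of the characteristic equation `x + x⁻¹ = z` gives `T_n(z) = xⁿ + x⁻ⁿ`. -/
theorem chebyshevC_eval_of_mul_eq_one {R : Type*} [CommRing R] {x y : R} (h : x * y = 1) (n : ℕ) :
    (Chebyshev.C R n).eval (x + y) = x ^ n + y ^ n := by
  induction n using Nat.twoStepInduction with
  | zero => simp; norm_num
  | one => simp
  | more n ih₁ ih₂ =>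
    have e : ((n + 2 : ℕ) : ℤ) = (n : ℤ) + 2 := by push_cast; ring
    have e' : ((n + 1 : ℕ) : ℤ) = (n : ℤ) + 1 := by push_cast; ring
    rw [e'] at ih₂
    rw [e, Chebyshev.C_add_two, eval_sub, eval_mul, eval_X, ih₁, ih₂]
    linear_combination (x ^ n + y ^ n) * h

/-- Needed twice: to pass to the quadratic extension of `R`, and from `ℤ` to `ℂ`. -/
theorem eval_map_chebyshevC {R S : Type*} [CommRing R] [CommRing S] (f : R →+* S) (n : ℤ) (z : R) :
    (Polynomial.Chebyshev.C S n).eval (f z) = f ((Polynomial.Chebyshev.C R n).eval z) := by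
  rw [← Polynomial.Chebyshev.map_C f, Polynomial.eval_map, Polynomial.eval₂_hom]

/-- `x` times the identity minus the matrix of the cyclic permutation. -/
def cyclicBidiagonal {R : Type*} [CommRing R] (n : ℕ) [NeZero n] (x : R) :
    Matrix (Fin n) (Fin n) R :=
  Matrix.of fun a b => (if a = b then x else 0) - (if a = b + 1 then 1 else 0)

/-- For `n ≥ 2` the first row has two nonzero entries: `x` at the left, whose minor is lower
triangular with diagonal `x`, and `-1` at the right, whose minor is upper triangular with diagonal
`-1`. -/
theorem det_cyclicBidiagonal {R : Type*} [CommRing R] (n : ℕ) [NeZero n] (x : R) :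
    (cyclicBidiagonal n x).det = x ^ n - 1 := by
  obtain _ | _ | m := n
  · exact absurd rfl (NeZero.ne 0)
  · simp [cyclicBidiagonal, Subsingleton.elim (1 : Fin 1) 0]
  · have hne : (0 : Fin (m + 2)) ≠ Fin.last (m + 1) := by simp [Fin.ext_iff]
    rw [Matrix.det_succ_row_zero, Fintype.sum_eq_add 0 (Fin.last (m + 1)) hne]
    · rw [Matrix.det_of_isLowerTriangular, Matrix.det_of_isUpperTriangular]
      · have h1 : ∀ i : Fin (m + 1), i.succ ≠ i.succ + 1 := by
          intro i; rw [Ne, Fin.ext_iff, Fin.val_add_one]; split_ifs <;> simp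
        have h2 : ∀ i : Fin (m + 1), i.succ ≠ i.castSucc := by
          intro i; simp [Fin.ext_iff]
        have h3 : ∀ i : Fin (m + 1), i.succ = i.castSucc + 1 := by simp
        have h4 : (0 : Fin (m + 2)) ≠ 0 + 1 := by simp
        have h5 : (0 : Fin (m + 2)) = Fin.last (m + 1) + 1 := by simp
        simp only [cyclicBidiagonal, Matrix.submatrix_apply, Matrix.of_apply, Fin.succAbove_zero,
          Fin.succAbove_last, if_neg (h1 _), if_neg (h2 _), if_pos (h3 _), if_neg h4, if_pos h5,
          if_neg hne, if_true, Finset.prod_const, Finset.card_univ, Fintype.card_fin,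
          Fin.val_last, Fin.val_zero]
        -- The cofactor sign of the corner entry cancels the product of the diagonal of its minor.
        have : ((-1 : R) ^ (m + 1)) * (-1) ^ (m + 1) = 1 := by
          rw [← mul_pow]; simp
        linear_combination -this
      · intro i j hij
        simp only [id, Fin.lt_def] at hij
        have e1 : i.succ ≠ j.castSucc := by simp [Fin.ext_iff]; omega
        have e2 : i ≠ j := by simp [Fin.ext_iff]; omega
        simp [cyclicBidiagonal, e1, e2]
      · intro i j hij
        replace hij : (i : ℕ) < j := by simpa using hij
        have e1 : i.succ ≠ j.succ := by simp [Fin.ext_iff]; omega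
        have e2 : i.succ ≠ j.succ + 1 := by
          rw [Ne, Fin.ext_iff, Fin.val_add_one]; split_ifs <;> simp; omega
        simp only [cyclicBidiagonal, Matrix.submatrix_apply, Matrix.of_apply, Fin.succAbove_zero,
          if_neg e1, if_neg e2, sub_zero]
    · rintro b ⟨h0, h1⟩
      have e : (0 : Fin (m + 2)) ≠ b + 1 := by
        rw [Ne, Fin.ext_iff, Fin.val_add_one, if_neg h1]; simp
      simp [cyclicBidiagonal, h0.symm, e]

theorem circulantCM_apply {R : Type*} [CommRing R] (n : ℕ) [NeZero n] (z : R) (a b : Fin n) :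
    circulantCM n z a b = (if a = b then -z else 0) + (if a = b + 1 then 1 else 0) +
      (if b = a + 1 then 1 else 0) := by
  have e1 : a - b = 0 ↔ a = b := sub_eq_zero
  have e2 : a - b = 1 ↔ a = b + 1 := by rw [sub_eq_iff_eq_add, add_comm]
  have e3 : a - b = -1 ↔ b = a + 1 := by
    rw [eq_neg_iff_add_eq_zero, sub_add_eq_add_sub, sub_eq_zero, eq_comm]
  simp only [circulantCM, Matrix.circulant_apply, e1, e2, e3]

/-- With `P Pᵀ = 1` the product is `x² + 1 - x(P + Pᵀ)`, and `x² + 1 = x(x + y)` because `xy = 1`.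
-/
theorem cyclicBidiagonal_mul_transpose {R : Type*} [CommRing R] (n : ℕ) [NeZero n] {x y : R}
    (h : x * y = 1) :
    cyclicBidiagonal n x * (cyclicBidiagonal n x).transpose = (-x) • circulantCM n (x + y) := by
  ext a b
  have e1 : ∀ c : Fin n, a = c + 1 ↔ c = a - 1 := fun c => by rw [eq_sub_iff_add_eq, eq_comm]
  have e2 : ∀ c : Fin n, b = c + 1 ↔ c = b - 1 := fun c => by rw [eq_sub_iff_add_eq, eq_comm]
  rw [Matrix.mul_apply, Matrix.smul_apply, circulantCM_apply]
  simp only [cyclicBidiagonal, Matrix.transpose_apply, Matrix.of_apply, e1, e2, mul_sub, sub_mul,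
    Finset.sum_sub_distrib, ite_mul, mul_ite, zero_mul, mul_zero, mul_one, one_mul,
    Finset.sum_ite_eq, Finset.sum_ite_eq', Finset.mem_univ, if_true, smul_eq_mul, sub_left_inj]
  rw [show (if b = a then (1 : R) else 0) = if a = b then 1 else 0 by simp only [eq_comm]]
  have : (if a = b then -(x + y) else 0) = -(x + y) * if a = b then 1 else 0 := by simp
  have h2 : (if a = b then x * x else 0) = x * x * if a = b then 1 else 0 := by simp
  have h3 : ∀ q : Prop, [Decidable q] → (if q then x else 0) = x * if q then 1 else 0 := by simp
  rw [this, h2, h3, h3]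
  linear_combination -(if a = b then (1 : R) else 0) * h

theorem det_circulantCM {R : Type*} [CommRing R] (n : ℕ) [NeZero n] (z : R) :
    (circulantCM n z).det = (-1) ^ n * ((Polynomial.Chebyshev.C R n).eval z - 2) := by
  -- Only over a nontrivial ring does `p` have degree `2`.
  nontriviality R
  let p : Polynomial R := Polynomial.X ^ 2 - Polynomial.C z * Polynomial.X + 1
  have hp : p.Monic := by
    simp only [p]; monicity!
  have hd : p.natDegree = 2 := by
    simp only [p]; compute_degree!
  -- A nonzero constant has smaller degree than the monic `p`, hence is not a multiple of it.
  have hinj : Function.Injective (AdjoinRoot.of p) := by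
    refine (injective_iff_map_eq_zero _).2 fun r hr => by_contra fun h0 => ?_
    exact AdjoinRoot.mk_ne_zero_of_natDegree_lt hp (Polynomial.C_ne_zero.2 h0)
      (by rw [Polynomial.natDegree_C, hd]; norm_num) hr
  apply hinj
  set f := AdjoinRoot.of p
  set x := AdjoinRoot.root p
  have hx : x * (f z - x) = 1 := by
    have : x ^ 2 - f z * x + 1 = 0 := by
      simpa [p] using AdjoinRoot.eval₂_root p
    linear_combination -this
  have hz : x + (f z - x) = f z := by ring
  -- The extension may have zero divisors; cancelling `(-x) ^ n` is possible because `x` is a unit.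
  have hxn : IsUnit ((-x) ^ n) := ((IsUnit.of_mul_eq_one _ hx).neg).pow n
  have hdet := congrArg Matrix.det (cyclicBidiagonal_mul_transpose n hx)
  rw [Matrix.det_mul, Matrix.det_transpose, det_cyclicBidiagonal, Matrix.det_smul,
    Fintype.card_fin, hz] at hdet
  have hC := chebyshevC_eval_of_mul_eq_one hx n
  rw [hz, eval_map_chebyshevC] at hC
  have hm : f (circulantCM n z).det = (circulantCM n (f z)).det := by
    rw [RingHom.map_det]
    congr 1
    ext a b
    simp [circulantCM_apply, apply_ite f]
  apply hxn.mul_left_cancel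
  have hxy : x ^ n * (f z - x) ^ n = 1 := by rw [← mul_pow, hx, one_pow]
  have hs : (-x) ^ n * (-1) ^ n = x ^ n := by rw [← mul_pow]; simp
  rw [hm, ← hdet, map_mul, map_sub, hC, map_pow, map_neg, map_one, map_ofNat, ← mul_assoc, hs]
  linear_combination -hxy

/-! ### Regions addressed by numerical coordinates. -/

namespace LinkDiagram

variable (D : LinkDiagram)

open Classical in
/-- The region that contains the gap `g` at height `t` (the unbounded one if there is no such gap). -/
noncomputable def regionAt (t g : ℕ) : D.Region :=
  if h : t < D.slices.length + 1 ∧ g < (D.level t).length + 1 then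
    D.region ⟨⟨t, h.1⟩, ⟨g, h.2⟩⟩
  else D.outer

/-- With plain numbers as coordinates, heights and gaps can be rewritten without transport between
dependent types. -/
theorem region_eq_regionAt (p : D.Gap) : D.region p = D.regionAt p.1 p.2 := by
  rw [regionAt, dif_pos ⟨p.1.2, p.2.2⟩]

theorem regionAt_zero : D.regionAt 0 0 = D.outer :=
  (D.region_eq_regionAt ⟨0, 0⟩).symm

variable {D}

theorem level_succ {t : ℕ} {s : Slice} (hs : D.slices[t]? = some s) :
    D.level (t + 1) = s.apply (D.level t) := by
  simp [level, List.take_add_one, hs]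

theorem regionAt_eq_of_joins {t g h : ℕ} {s : Slice} (hs : D.slices[t]? = some s)
    (hg : g ≤ (D.level t).length) (hh : h ≤ (D.level (t + 1)).length) (hj : s.Joins g h) :
    D.regionAt t g = D.regionAt (t + 1) h := by
  obtain ⟨ht, rfl⟩ := List.getElem?_eq_some_iff.1 hs
  rw [regionAt, regionAt, dif_pos ⟨by omega, by omega⟩, dif_pos ⟨by omega, by omega⟩]
  exact Quot.sound ⟨⟨t, ht⟩, rfl, rfl, hj⟩

theorem isWhite_regionAt {t g : ℕ} (ht : t ≤ D.slices.length) (hg : g ≤ (D.level t).length) :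
    D.IsWhite (D.regionAt t g) ↔ Even g := by
  rw [regionAt, dif_pos ⟨by omega, by omega⟩]
  rfl

/-- The length bounds guarantee that all four corners are actual gaps, so that `regionAt` never
takes its default value here. -/
theorem Crossing.connects_iff (c : D.Crossing) {t j : ℕ} (ht : (c.1 : ℕ) = t) (hj : c.pos = j)
    (h1 : j + 2 ≤ (D.level t).length) (h2 : j + 1 ≤ (D.level (t + 1)).length) (X Y : D.Region) :
    c.Connects X Y ↔
      ((D.regionAt t (j + 1) = X ∧ D.regionAt (t + 1) (j + 1) = Y) ∨
        (D.regionAt t (j + 1) = Y ∧ D.regionAt (t + 1) (j + 1) = X)) ∨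
      ((D.regionAt t j = X ∧ D.regionAt t (j + 2) = Y) ∨
        (D.regionAt t j = Y ∧ D.regionAt t (j + 2) = X)) := by
  have hlt : t < D.slices.length := ht ▸ c.1.2
  constructor
  · rintro ⟨p, q, hpq, h⟩
    rw [region_eq_regionAt, region_eq_regionAt] at h
    rcases hpq with ⟨e1, e2, e3, e4⟩ | ⟨e1, e2, e3, e4⟩
    · rw [e3, e4, e1, e2, ht, hj] at h
      exact Or.inl h
    · rw [e3, e4, e1, e2, ht, hj] at h
      exact Or.inr h
  · rintro (h | h)
    · refine ⟨⟨⟨t, by omega⟩, ⟨j + 1, by simp; omega⟩⟩, ⟨⟨t + 1, by omega⟩, ⟨j + 1, by simp; omega⟩⟩,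
        Or.inl ⟨ht.symm, by simp [ht], by simp [hj], by simp [hj]⟩, ?_⟩
      rw [region_eq_regionAt, region_eq_regionAt]
      exact h
    · refine ⟨⟨⟨t, by omega⟩, ⟨j, by simp; omega⟩⟩, ⟨⟨t, by omega⟩, ⟨j + 2, by simp; omega⟩⟩,
        Or.inr ⟨ht.symm, ht.symm, by simp [hj], by simp [hj]⟩, ?_⟩
      rw [region_eq_regionAt, region_eq_regionAt]
      exact h

end LinkDiagram

/-! ### Slices and strand directions of the Turk-head diagram. -/

namespace turkHead

variable (n : ℕ)

theorem slices_eq : (turkHead n).slices =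
    [Slice.cup 0 false, Slice.cup 1 false, Slice.cup 2 false] ++
      ((List.replicate n [Slice.cross 3 true, Slice.cross 4 false]).flatten ++
        [Slice.cap 2, Slice.cap 1, Slice.cap 0]) := by
  show BraidWord.closureSlices 3 _ = _
  simp [BraidWord.closureSlices, List.range_succ, List.map_flatten]

theorem length_flatten_replicate {α : Type*} (a b : α) :
    (List.replicate n [a, b]).flatten.length = 2 * n := by
  simp [mul_comm]

theorem getElem?_flatten_replicate {α : Type*} (a b : α) {i : ℕ} (hi : i < n) :
    (List.replicate n [a, b]).flatten[2 * i]? = some a ∧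
      (List.replicate n [a, b]).flatten[2 * i + 1]? = some b := by
  induction n generalizing i with
  | zero => omega
  | succ n ih =>
    cases i with
    | zero => simp [List.replicate_succ]
    | succ i =>
      have := ih (i := i) (by omega)
      simpa [List.replicate_succ, Nat.mul_add] using this

theorem length_slices : (turkHead n).slices.length = 2 * n + 6 := by
  simp only [slices_eq, List.length_append, length_flatten_replicate, List.length_cons,
    List.length_nil]
  omega

variable {n}

theorem slice_bottom {t : ℕ} (ht : t < 3) :
    (turkHead n).slices[t]? = some (Slice.cup t false) := by
  rw [slices_eq]
  interval_cases t <;> rfl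

theorem slice_body {i : ℕ} (hi : i < n) :
    (turkHead n).slices[3 + 2 * i]? = some (Slice.cross 3 true) ∧
      (turkHead n).slices[3 + 2 * i + 1]? = some (Slice.cross 4 false) := by
  have h := getElem?_flatten_replicate n (Slice.cross 3 true) (Slice.cross 4 false) hi
  have hl := length_flatten_replicate n (Slice.cross 3 true) (Slice.cross 4 false)
  rw [slices_eq, List.getElem?_append_right (by simp),
    List.getElem?_append_left (by rw [hl]; simp; omega),
    List.getElem?_append_right (by simp; omega),
    List.getElem?_append_left (by rw [hl]; simp; omega)]
  simp only [List.length_cons, List.length_nil]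
  rwa [show 3 + 2 * i - (0 + 1 + 1 + 1) = 2 * i by omega,
    show 3 + 2 * i + 1 - (0 + 1 + 1 + 1) = 2 * i + 1 by omega]

theorem slice_top {j : ℕ} (hj : j < 3) :
    (turkHead n).slices[2 * n + 3 + j]? = some (Slice.cap (2 - j)) := by
  have hl := length_flatten_replicate n (Slice.cross 3 true) (Slice.cross 4 false)
  rw [slices_eq, List.getElem?_append_right (by simp; omega),
    List.getElem?_append_right (by rw [hl]; simp; omega), hl]
  simp only [List.length_cons, List.length_nil]
  rw [show 2 * n + 3 + j - (0 + 1 + 1 + 1) - 2 * n = j by omega]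
  interval_cases j <;> rfl

theorem level_bottom {t : ℕ} (ht : t ≤ 3) : (turkHead n).level t = BraidWord.strands t := by
  induction t with
  | zero => rfl
  | succ t ih =>
    rw [LinkDiagram.level_succ (slice_bottom (by omega)), ih (by omega)]
    have : t < 3 := ht
    interval_cases t <;> rfl

theorem level_even {i : ℕ} (hi : i ≤ n) :
    (turkHead n).level (3 + 2 * i) = BraidWord.strands 3 := by
  induction i with
  | zero => exact level_bottom le_rfl
  | succ i ih =>
    have h := slice_body (n := n) (i := i) (by omega)
    rw [show 3 + 2 * (i + 1) = 3 + 2 * i + 1 + 1 by ring, LinkDiagram.level_succ h.2,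
      LinkDiagram.level_succ h.1, ih (by omega)]
    rfl

theorem level_odd {i : ℕ} (hi : i < n) :
    (turkHead n).level (3 + 2 * i + 1) = BraidWord.strands 3 := by
  rw [LinkDiagram.level_succ (slice_body hi).1, level_even hi.le]
  rfl

theorem level_top {j : ℕ} (hj : j ≤ 3) :
    (turkHead n).level (2 * n + 3 + j) = BraidWord.strands (3 - j) := by
  induction j with
  | zero => rw [add_zero, add_comm]; exact level_even le_rfl
  | succ j ih =>
    rw [← add_assoc, LinkDiagram.level_succ (slice_top (by omega)), ih (by omega)]
    have : j < 3 := hj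
    interval_cases j <;> rfl

/-- Every height lies below the braid, at or between its crossings, or above it. -/
theorem height_cases {t : ℕ} (ht : t ≤ 2 * n + 6) :
    t < 3 ∨ (∃ i ≤ n, t = 3 + 2 * i) ∨ (∃ i < n, t = 3 + 2 * i + 1) ∨
      ∃ j, 1 ≤ j ∧ j ≤ 3 ∧ t = 2 * n + 3 + j := by
  rcases lt_or_ge t 3 with h | h
  · exact Or.inl h
  · obtain ⟨k, rfl⟩ := Nat.exists_eq_add_of_le h
    rcases le_or_gt k (2 * n) with hk | hk
    · obtain ⟨i, rfl | rfl⟩ := Nat.even_or_odd' k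
      · exact Or.inr (Or.inl ⟨i, by omega, rfl⟩)
      · exact Or.inr (Or.inr (Or.inl ⟨i, by omega, rfl⟩))
    · exact Or.inr (Or.inr (Or.inr ⟨k - 2 * n, by omega, by omega, by omega⟩))

/-! ### An invariant that separates the white regions. -/

/-- `0`, except at the gaps of the annulus between the middle and the innermost closing strand:
there it is one more than the number of generators `σ₁` below, where the gaps above the last of
these and the gaps left of the braid count as gaps below the first. -/
def annulusLabel (n t g : ℕ) : ℕ :=
  if g = 4 ∧ 3 ≤ t ∧ t ≤ 2 * n + 3 then 1 + (if (t - 2) / 2 < n then (t - 2) / 2 else 0)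
  else if g = 2 ∧ 2 ≤ t ∧ t ≤ 2 * n + 4 then 1 else 0

/-- Regions are classes of a generated relation, so proving two of them different takes a function
on gaps that is constant along the generators. -/
theorem annulusLabel_eq_of_joins {t g h : ℕ} {s : Slice} (hs : (turkHead n).slices[t]? = some s)
    (hj : s.Joins g h) : annulusLabel n t g = annulusLabel n (t + 1) h := by
  have ht : t < 2 * n + 6 := by
    rw [← length_slices]; exact (List.getElem?_eq_some_iff.1 hs).1
  rcases height_cases ht.le with h3 | ⟨i, hi, rfl⟩ | ⟨i, hi, rfl⟩ | ⟨j, hj1, hj3, rfl⟩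
  · rw [slice_bottom h3, Option.some_inj] at hs
    subst hs
    simp only [Slice.Joins] at hj
    interval_cases t <;> simp only [annulusLabel] <;> split_ifs <;> omega
  · rcases hi.lt_or_eq with hi | rfl
    · rw [(slice_body hi).1, Option.some_inj] at hs
      subst hs
      simp only [Slice.Joins] at hj
      simp only [annulusLabel]; split_ifs <;> omega
    -- Above the last generator comes the innermost cap, which joins gap `4` to gap `2`; the label
    -- has to return to `1` here.
    · rw [show 3 + 2 * i = 2 * i + 3 + 0 by ring, slice_top (by omega), Option.some_inj] at hs
      subst hs
      simp only [Slice.Joins] at hj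
      simp only [annulusLabel]; split_ifs <;> omega
  · rw [(slice_body hi).2, Option.some_inj] at hs
    subst hs
    simp only [Slice.Joins] at hj
    simp only [annulusLabel]; split_ifs <;> omega
  · rw [slice_top (by omega), Option.some_inj] at hs
    subst hs
    simp only [Slice.Joins] at hj
    simp only [annulusLabel]; split_ifs <;> omega

/-- The label of a region. -/
def regionLabel : (turkHead n).Region → ℕ :=
  Quot.lift (fun p => annulusLabel n p.1 p.2) (by
    rintro p q ⟨t, h1, h2, h3⟩
    have h := annulusLabel_eq_of_joins (List.getElem?_eq_getElem t.2) h3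
    simp only [h1, h2, h])

theorem regionLabel_regionAt {t g : ℕ} (ht : t ≤ 2 * n + 6)
    (hg : g ≤ ((turkHead n).level t).length) :
    regionLabel ((turkHead n).regionAt t g) = annulusLabel n t g := by
  rw [LinkDiagram.regionAt, dif_pos ⟨by rw [length_slices]; omega, by omega⟩]
  rfl

end turkHead

/-! ### The list of all regions. -/

namespace turkHead

variable {n : ℕ}

theorem regionAt_bottom {t g h : ℕ} (ht : t < 3) (hg : g ≤ 2 * t) (hh : h ≤ 2 * t + 2)
    (hj : (g ≤ t ∧ h = g) ∨ (t ≤ g ∧ h = g + 2)) :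
    (turkHead n).regionAt t g = (turkHead n).regionAt (t + 1) h :=
  LinkDiagram.regionAt_eq_of_joins (slice_bottom ht)
    (by rw [level_bottom (by omega)]; simp [BraidWord.strands]; omega)
    (by rw [level_bottom (by omega)]; simp [BraidWord.strands]; omega) hj

/-- A generator `σ₁` interrupts only the gap between its two strands, which is gap `4`; for `σ₂⁻¹`
it is gap `5`. -/
theorem regionAt_even {i g : ℕ} (hi : i < n) (hg : g ≤ 6) (h4 : g ≠ 4) :
    (turkHead n).regionAt (3 + 2 * i) g = (turkHead n).regionAt (3 + 2 * i + 1) g :=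
  LinkDiagram.regionAt_eq_of_joins (slice_body hi).1
    (by rw [level_even hi.le]; simpa [BraidWord.strands])
    (by rw [level_odd hi]; simpa [BraidWord.strands]) ⟨h4, rfl⟩

theorem regionAt_odd {i g : ℕ} (hi : i < n) (hg : g ≤ 6) (h5 : g ≠ 5) :
    (turkHead n).regionAt (3 + 2 * i + 1) g = (turkHead n).regionAt (3 + 2 * (i + 1)) g :=
  LinkDiagram.regionAt_eq_of_joins (slice_body hi).2
    (by rw [level_odd hi]; simpa [BraidWord.strands])
    (by rw [show 3 + 2 * i + 1 + 1 = 3 + 2 * (i + 1) by ring, level_even hi]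
        simpa [BraidWord.strands]) ⟨h5, rfl⟩

theorem regionAt_top {j g h : ℕ} (hj : j < 3) (hg : g ≤ 2 * (3 - j)) (hh : h ≤ 2 * (2 - j))
    (H : (h ≤ 2 - j ∧ g = h) ∨ (2 - j ≤ h ∧ g = h + 2)) :
    (turkHead n).regionAt (2 * n + 3 + j) g = (turkHead n).regionAt (2 * n + 3 + j + 1) h :=
  LinkDiagram.regionAt_eq_of_joins (slice_top hj)
    (by rw [level_top (by omega)]; simp [BraidWord.strands]; omega)
    (by rw [add_assoc, level_top (by omega)]; simp [BraidWord.strands]; omega) H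

theorem regionAt_body {i g : ℕ} (hi : i ≤ n) (hg : g ≤ 6) (h4 : g ≠ 4) (h5 : g ≠ 5) :
    (turkHead n).regionAt (3 + 2 * i) g = (turkHead n).regionAt 3 g := by
  induction i with
  | zero => rfl
  | succ i ih => rw [← regionAt_odd hi hg h5, ← regionAt_even hi hg h4, ih (by omega)]

/-- The piece of the annulus between the middle and the innermost closing strand that lies above
the first `i` generators `σ₁`. -/
noncomputable def annulus (n i : ℕ) : (turkHead n).Region := (turkHead n).regionAt (3 + 2 * i) 4

/-- The piece of the annulus between the outermost and the middle closing strand that lies above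
the first `i` generators `σ₂⁻¹`. -/
noncomputable def outerAnnulus (n i : ℕ) : (turkHead n).Region :=
  (turkHead n).regionAt (3 + 2 * i) 5

/-- The region inside the innermost closing strand. -/
noncomputable def center (n : ℕ) : (turkHead n).Region := (turkHead n).regionAt 3 3

theorem regionAt_odd_four {i : ℕ} (hi : i < n) :
    (turkHead n).regionAt (3 + 2 * i + 1) 4 = annulus n (i + 1) :=
  regionAt_odd hi (by norm_num) (by norm_num)

theorem regionAt_odd_five {i : ℕ} (hi : i < n) :
    (turkHead n).regionAt (3 + 2 * i + 1) 5 = outerAnnulus n i :=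
  (regionAt_even hi (by norm_num) (by norm_num)).symm

theorem regionAt_three {i : ℕ} (hi : i ≤ n) : (turkHead n).regionAt (3 + 2 * i) 3 = center n :=
  regionAt_body hi (by norm_num) (by norm_num) (by norm_num)

theorem regionAt_one_zero : (turkHead n).regionAt 1 0 = (turkHead n).outer := by
  rw [← regionAt_bottom (t := 0) (g := 0) (by omega) (by omega) (by omega) (by omega),
    LinkDiagram.regionAt_zero]

theorem regionAt_one_two : (turkHead n).regionAt 1 2 = (turkHead n).outer := by
  rw [← regionAt_bottom (t := 0) (g := 0) (by omega) (by omega) (by omega) (by omega),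
    LinkDiagram.regionAt_zero]

theorem regionAt_two_zero : (turkHead n).regionAt 2 0 = (turkHead n).outer := by
  rw [← regionAt_bottom (t := 1) (g := 0) (by omega) (by omega) (by omega) (by omega),
    regionAt_one_zero]

theorem regionAt_two_four : (turkHead n).regionAt 2 4 = (turkHead n).outer := by
  rw [← regionAt_bottom (t := 1) (g := 2) (by omega) (by omega) (by omega) (by omega),
    regionAt_one_two]

theorem regionAt_three_zero : (turkHead n).regionAt 3 0 = (turkHead n).outer := by
  rw [← regionAt_bottom (t := 2) (g := 0) (by omega) (by omega) (by omega) (by omega),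
    regionAt_two_zero]

theorem regionAt_three_six : (turkHead n).regionAt 3 6 = (turkHead n).outer := by
  rw [← regionAt_bottom (t := 2) (g := 4) (by omega) (by omega) (by omega) (by omega),
    regionAt_two_four]

theorem regionAt_two_two : (turkHead n).regionAt 2 2 = annulus n 0 :=
  regionAt_bottom (t := 2) (g := 2) (by omega) (by omega) (by omega) (by omega)

theorem regionAt_three_two : (turkHead n).regionAt 3 2 = annulus n 0 := by
  rw [← regionAt_two_two]
  exact (regionAt_bottom (t := 2) (g := 2) (by omega) (by omega) (by omega) (by omega)).symm

theorem regionAt_two_three : (turkHead n).regionAt 2 3 = outerAnnulus n 0 :=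
  regionAt_bottom (t := 2) (g := 3) (by omega) (by omega) (by omega) (by omega)

theorem regionAt_one_one : (turkHead n).regionAt 1 1 = outerAnnulus n 0 := by
  rw [← regionAt_two_three]
  exact regionAt_bottom (t := 1) (g := 1) (by omega) (by omega) (by omega) (by omega)

theorem regionAt_two_one : (turkHead n).regionAt 2 1 = outerAnnulus n 0 := by
  rw [← regionAt_one_one]
  exact (regionAt_bottom (t := 1) (g := 1) (by omega) (by omega) (by omega) (by omega)).symm

theorem regionAt_three_one : (turkHead n).regionAt 3 1 = outerAnnulus n 0 := by
  rw [← regionAt_two_one]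
  exact (regionAt_bottom (t := 2) (g := 1) (by omega) (by omega) (by omega) (by omega)).symm

theorem regionAt_last {g : ℕ} :
    (turkHead n).regionAt (2 * n + 3 + 0) g = (turkHead n).regionAt (3 + 2 * n) g := by
  rw [add_zero, add_comm]

theorem regionAt_top_zero {j : ℕ} (hj : j ≤ 3) :
    (turkHead n).regionAt (2 * n + 3 + j) 0 = (turkHead n).outer := by
  induction j with
  | zero => rw [regionAt_last, regionAt_body le_rfl (by omega) (by omega) (by omega),
      regionAt_three_zero]
  | succ j ih =>
    rw [← ih (by omega)]
    exact (regionAt_top (by omega) (by omega) (by omega) (by omega)).symm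

theorem regionAt_top_one {j : ℕ} (hj : j ≤ 2) :
    (turkHead n).regionAt (2 * n + 3 + j) 1 = outerAnnulus n 0 := by
  induction j with
  | zero => rw [regionAt_last, regionAt_body le_rfl (by omega) (by omega) (by omega),
      regionAt_three_one]
  | succ j ih =>
    rw [← ih (by omega)]
    exact (regionAt_top (by omega) (by omega) (by omega) (by omega)).symm

theorem regionAt_top_two {j : ℕ} (hj : j ≤ 1) :
    (turkHead n).regionAt (2 * n + 3 + j) 2 = annulus n 0 := by
  induction j with
  | zero => rw [regionAt_last, regionAt_body le_rfl (by omega) (by omega) (by omega),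
      regionAt_three_two]
  | succ j ih =>
    rw [← ih (by omega)]
    exact (regionAt_top (by omega) (by omega) (by omega) (by omega)).symm

/-- Over the innermost cap gap `4` meets gap `2`, which runs down between the closing strands and
returns to gap `4` under the innermost cup. -/
theorem annulus_last : annulus n n = annulus n 0 := by
  rw [← regionAt_top_two (j := 1) le_rfl, annulus, ← regionAt_last]
  exact regionAt_top (by omega) (by omega) (by omega) (by omega)

theorem regionAt_top_three : (turkHead n).regionAt (2 * n + 3 + 1) 3 = outerAnnulus n 0 := by
  rw [← regionAt_top_one (j := 2) le_rfl]
  exact regionAt_top (by omega) (by omega) (by omega) (by omega)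

theorem outerAnnulus_last : outerAnnulus n n = outerAnnulus n 0 := by
  rw [← regionAt_top_three, outerAnnulus, ← regionAt_last]
  exact regionAt_top (by omega) (by omega) (by omega) (by omega)

theorem regionAt_top_outer {j g : ℕ} (hj : j ≤ 3) (hg : g = 2 * (3 - j)) :
    (turkHead n).regionAt (2 * n + 3 + j) g = (turkHead n).outer := by
  have h3 := regionAt_top_zero (n := n) (j := 3) le_rfl
  have h2 : (turkHead n).regionAt (2 * n + 3 + 2) 2 = (turkHead n).outer := by
    rw [← h3]
    exact regionAt_top (by omega) (by omega) (by omega) (by omega)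
  have h1 : (turkHead n).regionAt (2 * n + 3 + 1) 4 = (turkHead n).outer := by
    rw [← h2]
    exact regionAt_top (by omega) (by omega) (by omega) (by omega)
  subst hg
  interval_cases j
  · rw [regionAt_last, regionAt_body le_rfl (by omega) (by omega) (by omega)]
    exact regionAt_three_six
  · exact h1
  · exact h2
  · exact h3

theorem regionAt_six {i : ℕ} (hi : i < n) :
    (turkHead n).regionAt (3 + 2 * i + 1) 6 = (turkHead n).outer := by
  rw [← regionAt_even hi le_rfl (by norm_num), regionAt_body hi.le le_rfl (by norm_num)
    (by norm_num), regionAt_three_six]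

theorem region_cases_regionAt {t g : ℕ} (ht : t ≤ 2 * n + 6)
    (hg : g ≤ ((turkHead n).level t).length) :
    (turkHead n).regionAt t g = (turkHead n).outer ∨ (turkHead n).regionAt t g = center n ∨
      ∃ i ≤ n, (turkHead n).regionAt t g = annulus n i ∨
        (turkHead n).regionAt t g = outerAnnulus n i := by
  have body : ∀ i g, i ≤ n → g ≤ 6 →
      (turkHead n).regionAt (3 + 2 * i) g = (turkHead n).outer ∨
      (turkHead n).regionAt (3 + 2 * i) g = center n ∨
      ∃ k ≤ n, (turkHead n).regionAt (3 + 2 * i) g = annulus n k ∨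
        (turkHead n).regionAt (3 + 2 * i) g = outerAnnulus n k := by
    intro i g hi hg
    by_cases h4 : g = 4
    · exact Or.inr (Or.inr ⟨i, hi, Or.inl (by rw [h4]; rfl)⟩)
    by_cases h5 : g = 5
    · exact Or.inr (Or.inr ⟨i, hi, Or.inr (by rw [h5]; rfl)⟩)
    rw [regionAt_body hi hg h4 h5]
    interval_cases g
    · exact Or.inl regionAt_three_zero
    · exact Or.inr (Or.inr ⟨0, by omega, Or.inr regionAt_three_one⟩)
    · exact Or.inr (Or.inr ⟨0, by omega, Or.inl regionAt_three_two⟩)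
    · exact Or.inr (Or.inl rfl)
    · omega
    · omega
    · exact Or.inl regionAt_three_six
  rcases height_cases ht with h3 | ⟨i, hi, rfl⟩ | ⟨i, hi, rfl⟩ | ⟨j, hj1, hj3, rfl⟩
  · rw [level_bottom h3.le] at hg
    interval_cases t
    · obtain rfl : g = 0 := by simpa [BraidWord.strands] using hg
      exact Or.inl (LinkDiagram.regionAt_zero _)
    · replace hg : g ≤ 2 := by simpa [BraidWord.strands] using hg
      interval_cases g
      · exact Or.inl regionAt_one_zero
      · exact Or.inr (Or.inr ⟨0, by omega, Or.inr regionAt_one_one⟩)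
      · exact Or.inl regionAt_one_two
    · replace hg : g ≤ 4 := by simpa [BraidWord.strands] using hg
      interval_cases g
      · exact Or.inl regionAt_two_zero
      · exact Or.inr (Or.inr ⟨0, by omega, Or.inr regionAt_two_one⟩)
      · exact Or.inr (Or.inr ⟨0, by omega, Or.inl regionAt_two_two⟩)
      · exact Or.inr (Or.inr ⟨0, by omega, Or.inr regionAt_two_three⟩)
      · exact Or.inl regionAt_two_four
  · rw [level_even hi] at hg
    exact body i g hi (by simpa [BraidWord.strands] using hg)
  · rw [level_odd hi] at hg
    replace hg : g ≤ 6 := by simpa [BraidWord.strands] using hg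
    by_cases h5 : g = 5
    · rw [h5, regionAt_odd_five hi]
      exact Or.inr (Or.inr ⟨i, hi.le, Or.inr rfl⟩)
    · rw [regionAt_odd hi hg h5]
      exact body (i + 1) g hi hg
  · rw [level_top hj3] at hg
    replace hg : g ≤ 2 * (3 - j) := by
      simp only [BraidWord.strands, List.length_append, List.length_replicate] at hg
      omega
    by_cases h : g = 2 * (3 - j)
    · exact Or.inl (regionAt_top_outer hj3 h)
    have : g ≤ 3 := by omega
    interval_cases g
    · exact Or.inl (regionAt_top_zero hj3)
    · exact Or.inr (Or.inr ⟨0, by omega, Or.inr (regionAt_top_one (by omega))⟩)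
    · exact Or.inr (Or.inr ⟨0, by omega, Or.inl (regionAt_top_two (by omega))⟩)
    · obtain rfl : j = 1 := by omega
      exact Or.inr (Or.inr ⟨0, by omega, Or.inr regionAt_top_three⟩)

/-- The list has repetitions, since the indices `0` and `n` give the same pieces. That the white
regions in it are otherwise distinct comes from `regionLabel`; for the black ones this is not
needed. -/
theorem region_cases (X : (turkHead n).Region) : X = (turkHead n).outer ∨ X = center n ∨
    ∃ i ≤ n, X = annulus n i ∨ X = outerAnnulus n i := by
  induction X using Quot.ind with
  | mk p =>
    have h := (turkHead n).region_eq_regionAt p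
    have ht := p.1.2
    have hl := length_slices n
    have hg := p.2.2
    rw [show Quot.mk _ p = (turkHead n).region p from rfl, h]
    exact region_cases_regionAt (by omega) (by omega)

theorem isWhite_annulus {i : ℕ} (hi : i ≤ n) : (turkHead n).IsWhite (annulus n i) :=
  (LinkDiagram.isWhite_regionAt (by rw [length_slices]; omega)
    (by rw [level_even hi]; simp [BraidWord.strands])).2 (by decide)

theorem not_isWhite_outerAnnulus {i : ℕ} (hi : i ≤ n) :
    ¬ (turkHead n).IsWhite (outerAnnulus n i) := fun h =>
  absurd ((LinkDiagram.isWhite_regionAt (by rw [length_slices]; omega)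
    (by rw [level_even hi]; simp [BraidWord.strands])).1 h) (by decide)

theorem not_isWhite_center : ¬ (turkHead n).IsWhite (center n) := fun h =>
  absurd ((LinkDiagram.isWhite_regionAt (by rw [length_slices]; omega)
    (by rw [level_bottom le_rfl]; simp [BraidWord.strands])).1 h) (by decide)

theorem regionLabel_annulus {i : ℕ} (hi : i ≤ n) :
    regionLabel (annulus n i) = 1 + (if i < n then i else 0) := by
  rw [annulus, regionLabel_regionAt (by omega) (by rw [level_even hi]; simp [BraidWord.strands]),
    annulusLabel, if_pos (by omega), show (3 + 2 * i - 2) / 2 = i by omega]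

end turkHead

/-! ### Crossings: signs, types and the regions they connect. -/

namespace turkHead

variable {n : ℕ}

/-- The crossing of the `i`-th generator `σ₁`. -/
def crossingEven (i : Fin n) : (turkHead n).Crossing :=
  ⟨⟨3 + 2 * i, by rw [length_slices]; omega⟩, by
    have h := (List.getElem?_eq_some_iff.1 (slice_body i.2).1).2
    simp only [Fin.getElem_fin, h, Slice.IsCross]⟩

/-- The crossing of the `i`-th generator `σ₂⁻¹`. -/
def crossingOdd (i : Fin n) : (turkHead n).Crossing :=
  ⟨⟨3 + 2 * i + 1, by rw [length_slices]; omega⟩, by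
    have h := (List.getElem?_eq_some_iff.1 (slice_body i.2).2).2
    simp only [Fin.getElem_fin, h, Slice.IsCross]⟩

theorem slice_crossingEven (i : Fin n) :
    (turkHead n).slices[(crossingEven i).1] = Slice.cross 3 true :=
  (List.getElem?_eq_some_iff.1 (slice_body i.2).1).2

theorem slice_crossingOdd (i : Fin n) :
    (turkHead n).slices[(crossingOdd i).1] = Slice.cross 4 false :=
  (List.getElem?_eq_some_iff.1 (slice_body i.2).2).2

theorem crossingEven_pos (i : Fin n) : (crossingEven i).pos = 3 := by
  rw [LinkDiagram.Crossing.pos, slice_crossingEven, Slice.pos]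

theorem crossingOdd_pos (i : Fin n) : (crossingOdd i).pos = 4 := by
  rw [LinkDiagram.Crossing.pos, slice_crossingOdd, Slice.pos]

theorem blackVertical_crossingEven (i : Fin n) : ¬ (crossingEven i).BlackVertical := by
  rw [LinkDiagram.Crossing.BlackVertical, crossingEven_pos]; decide

theorem blackVertical_crossingOdd (i : Fin n) : (crossingOdd i).BlackVertical := by
  rw [LinkDiagram.Crossing.BlackVertical, crossingOdd_pos]; decide

theorem crossing_bijective :
    Function.Bijective (Sum.elim crossingEven crossingOdd : Fin n ⊕ Fin n → (turkHead n).Crossing) := by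
  constructor
  · rintro (i | i) (j | j) h <;>
      have h' := congrArg (fun c : (turkHead n).Crossing => (c.1 : ℕ)) h <;>
      simp only [Sum.elim_inl, Sum.elim_inr, crossingEven, crossingOdd] at h'
    · rw [Fin.ext (show (i : ℕ) = j by omega)]
    · omega
    · omega
    · rw [Fin.ext (show (i : ℕ) = j by omega)]
  · rintro ⟨⟨t, ht⟩, hc⟩
    have ht' := ht
    rw [length_slices] at ht'
    rcases height_cases (n := n) ht'.le with h3 | ⟨i, hi, rfl⟩ | ⟨i, hi, rfl⟩ | ⟨j, hj1, hj3, rfl⟩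
    · have h := (List.getElem?_eq_some_iff.1 (slice_bottom (n := n) h3)).2
      simp only [Fin.getElem_fin, h, Slice.IsCross] at hc
    · rcases hi.lt_or_eq with hi | rfl
      · exact ⟨Sum.inl ⟨i, hi⟩, rfl⟩
      · have h := (List.getElem?_eq_some_iff.1 (slice_top (n := i) (j := 0) (by omega))).2
        simp only [Fin.getElem_fin, show 3 + 2 * i = 2 * i + 3 + 0 by ring, h, Slice.IsCross] at hc
    · exact ⟨Sum.inr ⟨i, hi⟩, rfl⟩
    · have h := (List.getElem?_eq_some_iff.1 (slice_top (n := n) (j := j) (by omega))).2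
      simp only [Fin.getElem_fin, h, Slice.IsCross] at hc

/-- The crossings of the Turk-head diagram. -/
noncomputable def crossingEquiv (n : ℕ) : Fin n ⊕ Fin n ≃ (turkHead n).Crossing :=
  Equiv.ofBijective _ crossing_bijective

/-- The diagram is alternating: from `σ₁` to `σ₂⁻¹` the over-strand changes, but the shift by one
position also exchanges black and white corners. -/
theorem eta_eq (c : (turkHead n).Crossing) : c.eta = -1 := by
  obtain ⟨i | i, rfl⟩ := (crossingEquiv n).surjective c
  · show (crossingEven i).eta = -1
    rw [LinkDiagram.Crossing.eta, slice_crossingEven, if_neg]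
    simp [Slice.OverRising, blackVertical_crossingEven]
  · show (crossingOdd i).eta = -1
    rw [LinkDiagram.Crossing.eta, slice_crossingOdd, if_neg]
    simp [Slice.OverRising, blackVertical_crossingOdd]

/-- All braid strands run upwards, so the type depends only on whether the black corners lie above
and below the crossing or beside it. -/
theorem isTypeII_crossingEven (i : Fin n) : ¬ (crossingEven i).IsTypeII := by
  have : (crossingEven i).Parallel := by
    rw [LinkDiagram.Crossing.Parallel, crossingEven_pos]
    show ((turkHead n).level (3 + 2 * i))[3]? = ((turkHead n).level (3 + 2 * i))[3 + 1]?
    rw [level_even i.2.le]; rfl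
  rw [LinkDiagram.Crossing.IsTypeII]
  simp [this, blackVertical_crossingEven]

theorem isTypeII_crossingOdd (i : Fin n) : (crossingOdd i).IsTypeII := by
  have : (crossingOdd i).Parallel := by
    rw [LinkDiagram.Crossing.Parallel, crossingOdd_pos]
    show ((turkHead n).level (3 + 2 * i + 1))[4]? = ((turkHead n).level (3 + 2 * i + 1))[4 + 1]?
    rw [level_odd i.2]; rfl
  rw [LinkDiagram.Crossing.IsTypeII]
  simp [this, blackVertical_crossingOdd]

theorem typeII_bijective :
    Function.Bijective (fun i : Fin n => (⟨crossingOdd i, isTypeII_crossingOdd i⟩ :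
      (turkHead n).TypeII)) := by
  constructor
  · intro i j h
    exact Sum.inr_injective (crossing_bijective.1 (congrArg Subtype.val h))
  · rintro ⟨c, hc⟩
    obtain ⟨i | i, rfl⟩ := crossing_bijective.2 c
    · exact absurd hc (isTypeII_crossingEven i)
    · exact ⟨i, rfl⟩

theorem connects_crossingEven (i : Fin n) (X Y : (turkHead n).Region) :
    (crossingEven i).Connects X Y ↔
      ((annulus n i = X ∧ annulus n (i + 1) = Y) ∨ (annulus n i = Y ∧ annulus n (i + 1) = X)) ∨
      ((center n = X ∧ outerAnnulus n i = Y) ∨ (center n = Y ∧ outerAnnulus n i = X)) := by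
  rw [LinkDiagram.Crossing.connects_iff _ (t := 3 + 2 * i) rfl (crossingEven_pos i)
    (by rw [level_even i.2.le]; simp [BraidWord.strands])
    (by rw [level_odd i.2]; simp [BraidWord.strands]), regionAt_three i.2.le,
    regionAt_odd_four i.2]
  rfl

theorem connects_crossingOdd (i : Fin n) (X Y : (turkHead n).Region) :
    (crossingOdd i).Connects X Y ↔
      ((outerAnnulus n i = X ∧ outerAnnulus n (i + 1) = Y) ∨
        (outerAnnulus n i = Y ∧ outerAnnulus n (i + 1) = X)) ∨
      ((annulus n (i + 1) = X ∧ (turkHead n).outer = Y) ∨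
        (annulus n (i + 1) = Y ∧ (turkHead n).outer = X)) := by
  rw [LinkDiagram.Crossing.connects_iff _ (t := 3 + 2 * i + 1) rfl (crossingOdd_pos i)
    (by rw [level_odd i.2]; simp [BraidWord.strands])
    (by rw [show 3 + 2 * (i : ℕ) + 1 + 1 = 3 + 2 * (i + 1) by ring, level_even i.2]
        simp [BraidWord.strands]), regionAt_odd_four i.2, regionAt_six i.2,
    regionAt_odd_five i.2]
  rfl

/-- The black graph is connected as soon as there is a crossing. -/
theorem beta_eq_one [NeZero n] : (turkHead n).beta = 1 := by
  let o : (turkHead n).BlackRegion := ⟨center n, not_isWhite_center⟩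
  have key : ∀ X, (turkHead n).blackGraph.Reachable o X := by
    rintro ⟨X, hX⟩
    have leaf : ∀ i (hi : i < n), X = outerAnnulus n i →
        (turkHead n).blackGraph.Reachable o ⟨X, hX⟩ := by
      rintro i hi rfl
      -- `SimpleGraph.fromRel` has no loops; treating equality as a case avoids proving that the two
      -- black regions differ.
      by_cases h : o = ⟨outerAnnulus n i, hX⟩
      · rw [h]
      · refine SimpleGraph.Adj.reachable ?_
        rw [LinkDiagram.blackGraph, SimpleGraph.fromRel_adj]
        exact ⟨h, Or.inl ⟨crossingEven ⟨i, hi⟩,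
          (connects_crossingEven _ _ _).2 (Or.inr (Or.inl ⟨rfl, rfl⟩))⟩⟩
    obtain rfl | rfl | ⟨i, hi, rfl | rfl⟩ := region_cases X
    · exact absurd (LinkDiagram.isWhite_outer _) hX
    · exact SimpleGraph.Reachable.refl _
    · exact absurd (isWhite_annulus hi) hX
    · rcases hi.lt_or_eq with hi | rfl
      · exact leaf i hi rfl
      · exact leaf 0 (Nat.pos_of_ne_zero (NeZero.ne i)) outerAnnulus_last
  rw [LinkDiagram.beta, Nat.card_eq_one_iff_unique]
  refine ⟨⟨fun a b => ?_⟩, ⟨SimpleGraph.connectedComponentMk _ o⟩⟩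
  induction a using SimpleGraph.ConnectedComponent.ind with | _ X
  induction b using SimpleGraph.ConnectedComponent.ind with | _ Y
  exact SimpleGraph.ConnectedComponent.sound ((key X).symm.trans (key Y))

/-! ### White regions and the Goeritz matrix. -/

/-- The white regions: the unbounded one and the pieces of the annulus between the middle and the
innermost closing strand. -/
noncomputable def white : Option (Fin n) → (turkHead n).WhiteRegion
  | none => (turkHead n).whiteOuter
  | some a => ⟨annulus n a, isWhite_annulus a.2.le⟩

/-- The unbounded region has label `0` and the piece `a` has label `a + 1`, whence injectivity. For
`n = 0` surjectivity would fail: the annulus is then one uncut white region. -/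
theorem white_bijective [NeZero n] : Function.Bijective (white : Option (Fin n) → _) := by
  have h0 : ∀ a : Fin n, white none ≠ white (some a) := fun a h => by
    have := congrArg (fun X => regionLabel X.1) h
    simp only [white] at this
    rw [regionLabel_annulus a.2.le] at this
    change 0 = _ at this
    omega
  constructor
  · rintro (_ | a) (_ | b) h
    · rfl
    · exact absurd h (h0 b)
    · exact absurd h.symm (h0 a)
    · have := congrArg (fun X => regionLabel X.1) h
      simp only [white] at this
      rw [regionLabel_annulus a.2.le, regionLabel_annulus b.2.le, if_pos a.2, if_pos b.2] at this
      rw [Fin.ext (show (a : ℕ) = b by omega)]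
  · rintro ⟨X, hX⟩
    obtain rfl | rfl | ⟨i, hi, rfl | rfl⟩ := region_cases X
    · exact ⟨none, rfl⟩
    · exact absurd hX not_isWhite_center
    · rcases hi.lt_or_eq with hi | rfl
      · exact ⟨some ⟨i, hi⟩, rfl⟩
      · exact ⟨some 0, Subtype.ext (by simp [white, annulus_last])⟩
    · exact absurd hX (not_isWhite_outerAnnulus hi)

/-- Here the closing up of the annulus turns into addition modulo `n` in `Fin n`. -/
theorem annulus_succ [NeZero n] (i : Fin n) :
    annulus n (i + 1) = (white (some (i + 1))).1 := by
  have hv : ((i + 1 : Fin n) : ℕ) = (i + 1) % n := by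
    rw [Fin.val_add, Fin.val_one', Nat.add_mod_mod]
  show _ = annulus n ((i + 1 : Fin n) : ℕ)
  rw [hv]
  rcases (show (i : ℕ) + 1 ≤ n from i.2).lt_or_eq with h | h
  · rw [Nat.mod_eq_of_lt h]
  · rw [h, Nat.mod_self, annulus_last]

theorem connects_crossingEven_white [NeZero n] (i : Fin n) (x y : Option (Fin n)) :
    (crossingEven i).Connects (white x).1 (white y).1 ↔
      (some i = x ∧ some (i + 1) = y) ∨ (some i = y ∧ some (i + 1) = x) := by
  have e : ∀ u v : Option (Fin n), (white u).1 = (white v).1 ↔ u = v := fun u v =>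
    ⟨fun h => white_bijective.1 (Subtype.ext h), fun h => by rw [h]⟩
  have hc : ∀ u : Option (Fin n), center n ≠ (white u).1 := fun u h =>
    not_isWhite_center (h ▸ (white u).2)
  have hi : annulus n i = (white (some i)).1 := rfl
  rw [connects_crossingEven, annulus_succ, hi]
  simp only [e, hc, false_and, or_false]

theorem connects_crossingOdd_white [NeZero n] (i : Fin n) (x y : Option (Fin n)) :
    (crossingOdd i).Connects (white x).1 (white y).1 ↔
      (some (i + 1) = x ∧ none = y) ∨ (some (i + 1) = y ∧ none = x) := by
  have e : ∀ u v : Option (Fin n), (white u).1 = (white v).1 ↔ u = v := fun u v =>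
    ⟨fun h => white_bijective.1 (Subtype.ext h), fun h => by rw [h]⟩
  have hc : ∀ u : Option (Fin n), outerAnnulus n i ≠ (white u).1 := fun u h =>
    not_isWhite_outerAnnulus i.2.le (h ▸ (white u).2)
  have ho : (turkHead n).outer = (white (none : Option (Fin n))).1 := rfl
  rw [connects_crossingOdd, annulus_succ, ho]
  simp only [e, hc, false_and, false_or]

/-- Since every sign is `-1`, the entry simply counts connecting crossings. -/
theorem goeritzEntry_white [NeZero n] (x y : Option (Fin n)) :
    (turkHead n).goeritzEntry (white x) (white y) =
      (∑ i : Fin n,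
        if (some i = x ∧ some (i + 1) = y) ∨ (some i = y ∧ some (i + 1) = x) then 1 else 0) +
      ∑ i : Fin n,
        if (some (i + 1) = x ∧ none = y) ∨ (some (i + 1) = y ∧ none = x) then 1 else 0 := by
  classical
  rw [LinkDiagram.goeritzEntry, Finset.sum_filter, ← (crossingEquiv n).sum_comp,
    Fintype.sum_sum_type, neg_add, ← Finset.sum_neg_distrib, ← Finset.sum_neg_distrib]
  congr 1 <;> refine Finset.sum_congr rfl fun i _ => ?_
  · rw [eta_eq]
    show -(if (crossingEven i).Connects _ _ then (-1 : ℤ) else 0) = _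
    simp only [connects_crossingEven_white]
    split_ifs <;> rfl
  · rw [eta_eq]
    show -(if (crossingOdd i).Connects _ _ then (-1 : ℤ) else 0) = _
    simp only [connects_crossingOdd_white]
    split_ifs <;> rfl

theorem goeritzEntry_some_none [NeZero n] (a : Fin n) :
    (turkHead n).goeritzEntry (white (some a)) (white none) = 1 := by
  rw [goeritzEntry_white]
  -- Only the generator `σ₂⁻¹` with index `a - 1` contributes.
  simp [← eq_sub_iff_add_eq]

/-- The indicators belong to the generators `σ₁` with indices `b` and `a`. For `n = 2` both
crossings connect the two pieces, and the entry is `2`. -/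
theorem goeritzEntry_some_some [NeZero n] {a b : Fin n} (hab : a ≠ b) :
    (turkHead n).goeritzEntry (white (some a)) (white (some b)) =
      (if a = b + 1 then 1 else 0) + (if b = a + 1 then 1 else 0) := by
  rw [goeritzEntry_white]
  have h : ∀ i : Fin n,
      (if (some i = some a ∧ some (i + 1) = some b) ∨ (some i = some b ∧ some (i + 1) = some a)
        then (1 : ℤ) else 0) =
      (if i = b then if a = b + 1 then 1 else 0 else 0) +
        (if i = a then if b = a + 1 then 1 else 0 else 0) := by
    intro i
    simp only [Option.some_inj]
    by_cases h1 : i = a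
    · subst h1
      simp [hab, eq_comm]
    · by_cases h2 : i = b
      · subst h2
        simp [hab.symm, eq_comm]
      · simp [h1, h2]
  simp only [h, Finset.sum_add_distrib, Finset.sum_ite_eq', Finset.mem_univ, if_true]
  simp

/-- The parameter `3` is the valency of a rim vertex of the wheel: two neighbours on the rim and the
hub. -/
theorem unreducedGoeritz_some_some [NeZero n] (a b : Fin n) :
    (turkHead n).unreducedGoeritz (white (some a)) (white (some b)) = circulantCM n 3 a b := by
  classical
  have hinj : ∀ u v : Option (Fin n), white u = white v ↔ u = v := fun u v =>
    white_bijective.1.eq_iff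
  rw [LinkDiagram.unreducedGoeritz, Matrix.of_apply, circulantCM_apply]
  simp only [hinj, Option.some_inj]
  by_cases hab : a = b
  · subst hab
    rw [if_pos rfl, if_pos rfl, Finset.sum_filter,
      ← (Equiv.ofBijective _ (white_bijective (n := n))).sum_comp, Fintype.sum_option]
    simp only [Equiv.ofBijective_apply, ne_eq, hinj, reduceCtorEq, not_false_eq_true, if_true,
      goeritzEntry_some_none, Option.some_inj]
    -- The subtracted term is nonzero only for `n = 1`. There the crossing `σ₁` connects the single
    -- piece to itself and is left out of the row sum, so the diagonal entry is `-3 + 2`, as in the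
    -- circulant matrix.
    have h : ∀ c : Fin n, (if ¬ c = a then
        (turkHead n).goeritzEntry (white (some a)) (white (some c)) else 0) =
        (if c = a - 1 then 1 else 0) + (if c = a + 1 then 1 else 0) -
          (if c = a then 2 * (if a = a + 1 then 1 else 0) else 0) := by
      intro c
      have e : c = a - 1 ↔ a = c + 1 := by rw [eq_sub_iff_add_eq, eq_comm]
      by_cases hc : c = a
      · subst hc
        rw [if_neg (by simp), if_pos rfl]
        simp only [e]
        ring
      · rw [if_pos hc, if_neg hc, goeritzEntry_some_some (Ne.symm hc)]
        simp only [e, sub_zero]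
    simp only [h, Finset.sum_sub_distrib, Finset.sum_add_distrib, Finset.sum_ite_eq',
      Finset.mem_univ, if_true]
    ring
  · rw [if_neg hab, if_neg hab, goeritzEntry_some_some hab, zero_add]

theorem white_some_bijective [NeZero n] : Function.Bijective
    (fun a : Fin n => (⟨white (some a), fun h =>
      Option.some_ne_none a (white_bijective.1 (a₁ := some a) (a₂ := none) h)⟩ :
        {X : (turkHead n).WhiteRegion // X ≠ (turkHead n).whiteOuter})) := by
  constructor
  · intro a b h
    exact Option.some_injective _ (white_bijective.1 (congrArg Subtype.val h))
  · rintro ⟨X, hX⟩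
    obtain ⟨_ | a, rfl⟩ := white_bijective.2 X
    · exact absurd rfl hX
    · exact ⟨a, rfl⟩

open Classical in
theorem det_goeritz [NeZero n] : (turkHead n).goeritz.det = (circulantCM n (3 : ℤ)).det := by
  rw [← Matrix.det_submatrix_equiv_self (Equiv.ofBijective _ (white_some_bijective (n := n)))]
  congr 1
  ext a b
  exact unreducedGoeritz_some_some a b

/-! ### The determinant of the Turk-head links. -/

theorem Det_eq_of_neZero [NeZero n] :
    (turkHead n).Det = (Polynomial.Chebyshev.C ℂ n).eval 3 - 2 := by
  classical
  have hempty : IsEmpty (Fin ((turkHead n).beta - 1)) := by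
    exact ⟨fun x => by have := x.2; have := beta_eq_one (n := n); omega⟩
  have hG : (turkHead n).generalizedGoeritz.det =
      (-1) ^ n * ((Polynomial.Chebyshev.C ℤ n).eval 3 - 2) := by
    rw [LinkDiagram.generalizedGoeritz, Matrix.det_fromBlocks_zero₁₂,
      Matrix.det_fromBlocks_zero₁₂, Matrix.det_diagonal,
      Matrix.det_isEmpty (n := Fin ((turkHead n).beta - 1)), mul_one]
    simp only [eta_eq, neg_neg, Finset.prod_const_one, mul_one]
    rw [← det_circulantCM, ← det_goeritz]
  have hcard : Fintype.card ({X : (turkHead n).WhiteRegion // X ≠ (turkHead n).whiteOuter} ⊕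
      ((turkHead n).TypeII ⊕ Fin ((turkHead n).beta - 1))) = 2 * n := by
    rw [Fintype.card_sum, Fintype.card_sum, Fintype.card_eq_zero (α := Fin _),
      Fintype.card_congr (Equiv.ofBijective _ (white_some_bijective (n := n))).symm,
      Fintype.card_congr (Equiv.ofBijective _ (typeII_bijective (n := n))).symm, Fintype.card_fin]
    ring
  have hmap : ((turkHead n).generalizedGoeritz.map (Int.cast : ℤ → ℂ)).det =
      (((turkHead n).generalizedGoeritz.det : ℤ) : ℂ) :=
    ((Int.castRingHom ℂ).map_det _).symm
  rw [LinkDiagram.Det, Matrix.det_smul]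
  have h3 : (Polynomial.Chebyshev.C ℂ n).eval 3 =
      (((Polynomial.Chebyshev.C ℤ n).eval 3 : ℤ) : ℂ) := by
    have := eval_map_chebyshevC (Int.castRingHom ℂ) n 3
    simpa using this
  -- The scalar `i` enters once for each of the `n` rim regions and the `n` crossings of type II.
  have hpow : (Complex.I ^ (2 * n)) * (-1) ^ n = 1 := by
    rw [pow_mul, Complex.I_sq, ← mul_pow]; simp
  have e : ((turkHead n).generalizedGoeritz.map (Int.cast : ℤ → ℂ)).det =
      (-1) ^ n * ((((Polynomial.Chebyshev.C ℤ n).eval 3 : ℤ) : ℂ) - 2) := by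
    rw [hmap, hG]; push_cast; rfl
  rw [hcard, e, h3]
  linear_combination ((((Polynomial.Chebyshev.C ℤ n).eval 3 : ℤ) : ℂ) - 2) * hpow

/-- The diagram consists of three nested circles. Without crossings the Goeritz matrix is zero, and
the bounded white annulus ensures that it has a row. -/
theorem Det_zero : (turkHead 0).Det = 0 := by
  classical
  have hne : (⟨annulus 0 0, isWhite_annulus le_rfl⟩ : (turkHead 0).WhiteRegion) ≠
      (turkHead 0).whiteOuter := fun h => by
    have := congrArg (fun X => regionLabel X.1) h
    simp only [regionLabel_annulus le_rfl] at this
    change _ = 0 at this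
    omega
  have hg : (turkHead 0).goeritz = 0 := by
    have : IsEmpty (turkHead 0).Crossing := (crossingEquiv 0).symm.isEmpty
    ext X Y
    simp [LinkDiagram.goeritz, LinkDiagram.unreducedGoeritz, LinkDiagram.goeritzEntry]
  rw [LinkDiagram.Det]
  refine Matrix.det_eq_zero_of_row_eq_zero (Sum.inl ⟨_, hne⟩) fun j => ?_
  rcases j with j | j <;> simp [LinkDiagram.generalizedGoeritz, hg]

theorem Det_eq (n : ℕ) : (turkHead n).Det = (Polynomial.Chebyshev.C ℂ n).eval 3 - 2 := by
  rcases Nat.eq_zero_or_pos n with rfl | h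
  · simp [Det_zero]
  · have : NeZero n := ⟨h.ne'⟩
    exact Det_eq_of_neZero

/-- The two bases are the roots of `x² - 3x + 1`, with sum `3` and product `1`. -/
theorem Det_eq_golden (n : ℕ) : (turkHead n).Det =
    ((((3 + √5) / 2) ^ n + ((3 - √5) / 2) ^ n - 2 : ℝ) : ℂ) := by
  have h5 : √5 * √5 = (5 : ℝ) := Real.mul_self_sqrt (by norm_num)
  have h1 : ((3 + √5) / 2) * ((3 - √5) / 2) = (1 : ℝ) := by linear_combination -h5 / 4
  have h := chebyshevC_eval_of_mul_eq_one h1 n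
  rw [show (3 + √5) / 2 + (3 - √5) / 2 = (3 : ℝ) by ring] at h
  rw [Det_eq, ← h, Complex.ofReal_sub]
  simp

end turkHead

theorem mainTheorem8 :
    (∀ (R : Type*) [CommRing R] (n : ℕ) [NeZero n] (z : R),
      (circulantCM n z).det = (-1) ^ n * ((Polynomial.Chebyshev.C R n).eval z - 2)) ∧
    (∀ n : ℕ,
      (turkHead n).Det
          = ((((3 + √5) / 2) ^ n + ((3 - √5) / 2) ^ n - 2 : ℝ) : ℂ) ∧
      (turkHead n).Det = (Polynomial.Chebyshev.C ℂ n).eval 3 - 2) ∧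
    (turkHead 2).Det = 5 ∧ (turkHead 3).Det = 16 ∧ (turkHead 4).Det = 45 ∧
    (turkHead 5).Det = 121 ∧ (turkHead 6).Det = 320 ∧ (turkHead 7).Det = 841 ∧
    (turkHead 8).Det = 2205 := by
  refine ⟨fun R _ n _ z => det_circulantCM n z,
    fun n => ⟨turkHead.Det_eq_golden n, turkHead.Det_eq n⟩, ?_⟩
  -- The numerical values come from the recurrence `u (n + 2) = 3 * u (n + 1) - u n`, run down to `u
  -- 0` and `u 1`, rather than from the closed form with `√5`.
  let u : ℕ → ℂ := fun n => (Polynomial.Chebyshev.C ℂ n).eval 3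
  have h0 : u 0 = 2 := by simp [u]
  have h1 : u 1 = 3 := by simp [u]
  have hrec : ∀ n, u (n + 2) = 3 * u (n + 1) - u n := fun n => by
    have := Polynomial.Chebyshev.C_add_two ℂ (n : ℤ)
    simp only [u]
    push_cast
    rw [this]
    simp
  have hD : ∀ n, (turkHead n).Det = u n - 2 := turkHead.Det_eq
  simp only [hD, hrec, h0, h1]
  norm_num
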